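/- Let $n,b\ge 1$ be integers with $b<\frac n2$, let $R>0$, and let $\xi_1,\dots,\xi_b$ be independent identically distributed real random variables taking values in $[0,R]$. Let $A_{n,b}$ be the random $n\times n$ real symmetric band circulant matrix $\mathrm{Circ}(0,\xi_1,\dots,\xi_b,0,\dots,0,\xi_b,\dots,\xi_1)$, where $\mathrm{Circ}(a_0,\dots,a_{n-1})$ denotes the matrix with $(i,j)$ entry $a_{(j-i)\bmod n}$, and let $\mathcal{E}(A):=\mathrm{tr}\,|A|$, $|A|=(A^*A)^{1/2}$, be the matrix energy (trace norm) of $A$, i.e. the sum of its singular values. Put $\delta_0(b):=4\sqrt{\frac{2\pi R^2}{b}}$. Then $\mathcal{E}(A_{n,b})$ is integrable, and for every $\delta\ge\delta_0(b)$ $$\mathbb{P}\left\{\left|\frac1{n\sqrt b}\,\mathcal{E}(A_{n,b})-\frac1{n\sqrt b}\,\mathbb{E}\,\mathcal{E}(A_{n,b})\right|\ge\delta\right\}\le 4\,e^{-\frac{b}{8R^2}\left(\delta-\delta_0(b)\right)^2}.$$ -/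

import Mathlib

open MeasureTheory ProbabilityTheory

noncomputable section

namespace BandCirculant

/-- The circulant `Circ(a₀, …, a_{n-1})`: the matrix whose `(i, j)` entry is `a_{(j - i) mod n}`.
(Subtraction in `Fin n` is modulo `n`; Mathlib's `Matrix.circulant` uses `i - j` instead.) -/
def circ {α : Type*} {n : ℕ} (a : Fin n → α) : Matrix (Fin n) (Fin n) α :=
  (Matrix.circulant a).transpose

theorem circ_apply {α : Type*} {n : ℕ} (a : Fin n → α) (i j : Fin n) :
    circ a i j = a (j - i) := rfl

/-- The palindromic tuple `(0, x₁, …, x_b, 0, …, 0, x_b, …, x₁)` of length `n` (for `2 * b < n`).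
The entry `x_k` (`1 ≤ k ≤ b`) of the mathematical notation is `x ⟨k - 1, _⟩` here. -/
def bandTuple {α : Type*} [Zero α] (n b : ℕ) (x : Fin b → α) (k : Fin n) : α :=
  if h : 1 ≤ (k : ℕ) ∧ (k : ℕ) ≤ b then x ⟨(k : ℕ) - 1, by omega⟩
  else if h' : 1 ≤ n - (k : ℕ) ∧ n - (k : ℕ) ≤ b then x ⟨n - (k : ℕ) - 1, by omega⟩
  else 0

/-- The real symmetric band circulant `Circ(0, x₁, …, x_b, 0, …, 0, x_b, …, x₁)` of size `n`. -/
def bandCirc {α : Type*} [Zero α] (n b : ℕ) (x : Fin b → α) : Matrix (Fin n) (Fin n) α :=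
  circ (bandTuple n b x)

/-- The matrix energy (trace norm) `tr |A|`, i.e. the sum of the singular values of `A`, which are
the nonnegative square roots of the eigenvalues (with multiplicity) of `A* A`. -/
def energy {n : ℕ} (A : Matrix (Fin n) (Fin n) ℝ) : ℝ :=
  ∑ r, √((Matrix.isHermitian_conjTranspose_mul_self A).eigenvalues r)

/-- `δ₀(b) = 4 √(2 π R² / b)`. -/
def delta0 (R : ℝ) (b : ℕ) : ℝ := 4 * √(2 * Real.pi * R ^ 2 / b)

end BandCirculant

end

/-! ### Maurey's convex property (τ) on the cube -/

namespace BandCirculant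

open Set ENNReal

/-! The energy of a circulant is the sum of the moduli of its Fourier coefficients (`energy_circ`),
which are linear in the entries. It is therefore convex in `x`, and Cauchy–Schwarz on the singular
values makes it `n√2`-Lipschitz (`energy_bandCirc_le_add`).

Concentration comes from Maurey's property (τ): for convex `f` and `Qf(x) = min_y (f y + |x - y|² /
(4R²))` over the cube, `E exp(Qf) · E exp(-f) ≤ 1`. If `F` is `L`-Lipschitz and `t ≥ 0`, then `Q(tF)
≥ tF - t²L²R²`, so the mgf of `F` satisfies `mgf t * mgf (-t) ≤ exp(t²L²R²)`. After centring, both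
factors are at least 1 by Jensen, so each is bounded by the right side: `F - E F` is sub-Gaussian
with proxy `2L²R²`. Centring at the mean directly, with no median, gives a tail bound without the
shift `delta0`; the stated one is weaker. -/

lemma exp_sub_sq_add_exp_neg_le_two {t : ℝ} (h0 : 0 ≤ t) (h1 : t ≤ 4) :
    Real.exp (t - t ^ 2) + Real.exp (-t) ≤ 2 := by
  have e1 : Real.exp (t - t ^ 2) + Real.exp (-t)
      = 2 * (Real.exp (-(t ^ 2 / 2)) * Real.cosh (t - t ^ 2 / 2)) := by
    rw [Real.cosh_eq, mul_div_assoc', mul_div_cancel₀ _ two_ne_zero, mul_add, ← Real.exp_add,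
      ← Real.exp_add]
    congr 2 <;> ring
  have e2 : Real.exp (-(t ^ 2 / 2)) * Real.cosh (t - t ^ 2 / 2) ≤ 1 := by
    -- The quadratic terms of the exponents cancel, leaving `-t³(4 - t)/8`; hence the range `t ≤ 4`.
    calc _ ≤ Real.exp (-(t ^ 2 / 2)) * Real.exp ((t - t ^ 2 / 2) ^ 2 / 2) := by
          gcongr; exact Real.cosh_le_exp_half_sq _
      _ = Real.exp (-(t ^ 3 * (4 - t) / 8)) := by rw [← Real.exp_add]; congr 1; ring
      _ ≤ 1 := by
          rw [Real.exp_le_one_iff, neg_nonpos]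
          have : 0 ≤ 4 - t := by linarith
          positivity
  rw [e1]; linarith

/-- Moving from `x` towards a minimiser of a convex function `f` on `[0, R]`. -/
lemma exists_exp_add_sq_le {R : ℝ} (hR : 0 < R) {f : ℝ → ℝ} (hf : ConvexOn ℝ univ f)
    {x z : ℝ} (hx : x ∈ Icc 0 R) (hz : z ∈ Icc 0 R) (hzx : f z ≤ f x) :
    ∃ y ∈ Icc 0 R, Real.exp (f y + (x - y) ^ 2 / (4 * R ^ 2))
      ≤ Real.exp (f z) * (2 - Real.exp (-(f x - f z))) := by
  have key : ∀ θ : ℝ, 0 ≤ θ → θ ≤ 1 → ∃ y ∈ Icc 0 R, f y + (x - y) ^ 2 / (4 * R ^ 2)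
      ≤ f z + ((1 - θ) * (f x - f z) + θ ^ 2 / 4) := by
    intro θ h0 h1
    refine ⟨(1 - θ) * x + θ * z,
      (convex_Icc 0 R) hx hz (by linarith) h0 (by ring), ?_⟩
    have c := hf.2 (mem_univ x) (mem_univ z) (show 0 ≤ 1 - θ by linarith) h0 (by ring)
    simp only [smul_eq_mul] at c
    have hsq : (x - z) ^ 2 ≤ R ^ 2 := by
      apply sq_le_sq'
      · linarith [hx.1, hz.2]
      · linarith [hx.2, hz.1]
    have d : (x - ((1 - θ) * x + θ * z)) ^ 2 / (4 * R ^ 2) ≤ θ ^ 2 / 4 := by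
      rw [show x - ((1 - θ) * x + θ * z) = θ * (x - z) by ring, mul_pow,
        div_le_div_iff₀ (by positivity) (by norm_num)]
      nlinarith [mul_le_mul_of_nonneg_left hsq (sq_nonneg θ)]
    linarith
  -- With `d = f x - f z`, the bound `(1 - θ)d + θ²/4` is least at `θ = 2d`, with value `d - d²`.
  -- For `d ≥ 1/2` this `θ` is capped at 1, and the value `1/4` is that of `t - t²` at `t = 1/2`.
  rcases le_total (f x - f z) (1 / 2) with h | h
  · obtain ⟨y, hy, hle⟩ := key (2 * (f x - f z)) (by linarith) (by linarith)
    refine ⟨y, hy, (Real.exp_le_exp.2 hle).trans ?_⟩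
    rw [Real.exp_add]
    gcongr
    have := exp_sub_sq_add_exp_neg_le_two (t := f x - f z) (by linarith) (by linarith)
    rw [show (1 - 2 * (f x - f z)) * (f x - f z) + (2 * (f x - f z)) ^ 2 / 4
      = (f x - f z) - (f x - f z) ^ 2 by ring]
    linarith
  · obtain ⟨y, hy, hle⟩ := key 1 (by norm_num) le_rfl
    refine ⟨y, hy, (Real.exp_le_exp.2 hle).trans ?_⟩
    rw [Real.exp_add]
    gcongr
    have := exp_sub_sq_add_exp_neg_le_two (t := 1 / 2) (by norm_num) (by norm_num)
    have h2 : Real.exp (-(f x - f z)) ≤ Real.exp (-(1 / 2)) := Real.exp_le_exp.2 (by linarith)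
    rw [show (1 / 2 : ℝ) - (1 / 2) ^ 2 = 1 / 4 by norm_num] at this
    rw [show (1 - 1) * (f x - f z) + 1 ^ 2 / 4 = (1 / 4 : ℝ) by ring]
    linarith

lemma _root_.ConvexOn.continuous_of_univ {E : Type*} [NormedAddCommGroup E] [NormedSpace ℝ E]
    [FiniteDimensional ℝ E] {f : E → ℝ} (hf : ConvexOn ℝ univ f) : Continuous f :=
  continuousOn_univ.1 (hf.continuousOn isOpen_univ)

/-- Maurey's convex property (τ) on an interval. -/
lemma lintegral_mul_lintegral_exp_neg_le_one_of_convexOn {R : ℝ} (hR : 0 < R) {μ : Measure ℝ}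
    [IsProbabilityMeasure μ] (hμ : ∀ᵐ x ∂μ, x ∈ Icc 0 R) {f : ℝ → ℝ} (hf : ConvexOn ℝ univ f)
    {u : ℝ → ℝ≥0∞} (hu : ∀ x ∈ Icc 0 R, ∀ y ∈ Icc 0 R,
      u x ≤ ENNReal.ofReal (Real.exp (f y + (x - y) ^ 2 / (4 * R ^ 2)))) :
    (∫⁻ x, u x ∂μ) * ∫⁻ x, ENNReal.ofReal (Real.exp (-f x)) ∂μ ≤ 1 := by
  have hfc : Continuous f := hf.continuous_of_univ
  obtain ⟨z, hz, hmin⟩ := isCompact_Icc.exists_isMinOn (nonempty_Icc.2 hR.le) hfc.continuousOn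
  set w : ℝ → ℝ := fun x => Real.exp (-(f x - f z)) with hw
  have hw1 : ∀ᵐ x ∂μ, w x ≤ 1 := by
    filter_upwards [hμ] with x hx
    have : f z ≤ f x := hmin hx
    exact Real.exp_le_one_iff.2 (by linarith)
  have hw0 : ∀ x, 0 ≤ w x := fun x => (Real.exp_pos _).le
  have hwi : Integrable w μ := by
    refine Integrable.of_bound (C := 1) (by fun_prop) ?_
    filter_upwards [hw1] with x hx
    rwa [Real.norm_of_nonneg (hw0 x)]
  have h1 : ∫⁻ x, u x ∂μ ≤ ENNReal.ofReal (Real.exp (f z) * (2 - ∫ x, w x ∂μ)) := by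
    have e : Real.exp (f z) * (2 - ∫ x, w x ∂μ) = ∫ x, Real.exp (f z) * (2 - w x) ∂μ := by
      rw [integral_const_mul, integral_sub (integrable_const _) hwi]
      simp
    rw [e, ofReal_integral_eq_lintegral_ofReal]
    · apply lintegral_mono_ae
      filter_upwards [hμ] with x hx
      obtain ⟨y, hy, hxy⟩ := exists_exp_add_sq_le hR hf hx hz (hmin hx)
      exact (hu x hx y hy).trans (ENNReal.ofReal_le_ofReal hxy)
    · exact ((integrable_const _).sub hwi).const_mul _
    · filter_upwards [hw1] with x hx
      exact mul_nonneg (Real.exp_pos _).le (by linarith)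
  have h2 : ∫⁻ x, ENNReal.ofReal (Real.exp (-f x)) ∂μ
      = ENNReal.ofReal (Real.exp (-f z) * ∫ x, w x ∂μ) := by
    rw [← integral_const_mul, ofReal_integral_eq_lintegral_ofReal (hwi.const_mul _)]
    · refine lintegral_congr fun x => ?_
      rw [hw, ← Real.exp_add]
      congr 2; ring
    · exact .of_forall fun x => mul_nonneg (Real.exp_pos _).le (hw0 x)
  have hI0 : 0 ≤ ∫ x, w x ∂μ := integral_nonneg hw0
  rw [h2]
  refine (mul_le_mul_left h1 _).trans ?_
  rw [← ENNReal.ofReal_mul' (by positivity)]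
  refine ENNReal.ofReal_le_one.2 ?_
  have : Real.exp (f z) * Real.exp (-f z) = 1 := by rw [← Real.exp_add]; simp
  -- The factors `exp(± f z)` cancel and `(2 - I) I ≤ 1` for every real `I`.
  calc _ = (Real.exp (f z) * Real.exp (-f z)) * ((2 - ∫ x, w x ∂μ) * ∫ x, w x ∂μ) := by ring
    _ ≤ 1 := by rw [this]; nlinarith [sq_nonneg (1 - ∫ x, w x ∂μ)]

/-- Partial minimisation of a jointly convex function is convex. -/
lemma convexOn_univ_of_isLeast {E F : Type*} [AddCommGroup E] [Module ℝ E] [AddCommGroup F]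
    [Module ℝ F] {K : Set F} (hK : Convex ℝ K) {G : E → F → ℝ}
    (hG : ConvexOn ℝ univ fun p : E × F => G p.1 p.2) {q : E → ℝ}
    (hq : ∀ x, IsLeast (G x '' K) (q x)) : ConvexOn ℝ univ q := by
  refine ⟨convex_univ, fun x _ y _ a b ha hb hab => ?_⟩
  obtain ⟨⟨s, hs, hsx⟩, -⟩ := hq x
  obtain ⟨⟨t, ht, hty⟩, -⟩ := hq y
  refine ((hq (a • x + b • y)).2 ⟨a • s + b • t, hK hs ht ha hb hab, rfl⟩).trans ?_
  rw [← hsx, ← hty]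
  exact hG.2 (mem_univ (x, s)) (mem_univ (y, t)) ha hb hab

/-- An integral of log-convex functions is log-convex. -/
lemma convexOn_log_lintegral_exp {S E : Type*} [MeasurableSpace S] [AddCommGroup E] [Module ℝ E]
    {μ : Measure S} {q : S → E → ℝ} (hq : ∀ s, ConvexOn ℝ univ (q s))
    (hm : ∀ y, Measurable fun s => q s y)
    (h0 : ∀ y, ∫⁻ s, ENNReal.ofReal (Real.exp (q s y)) ∂μ ≠ 0)
    (htop : ∀ y, ∫⁻ s, ENNReal.ofReal (Real.exp (q s y)) ∂μ ≠ ∞) :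
    ConvexOn ℝ univ fun y => Real.log (∫⁻ s, ENNReal.ofReal (Real.exp (q s y)) ∂μ).toReal := by
  set I : E → ℝ≥0∞ := fun y => ∫⁻ s, ENNReal.ofReal (Real.exp (q s y)) ∂μ with hI
  have hpos : ∀ y, 0 < (I y).toReal := fun y => ENNReal.toReal_pos (h0 y) (htop y)
  refine ⟨convex_univ, fun x _ y _ a b ha hb hab => ?_⟩
  have hold : I (a • x + b • y) ≤ I x ^ a * I y ^ b := by
    calc I (a • x + b • y)
        ≤ ∫⁻ s, ENNReal.ofReal (Real.exp (q s x)) ^ a * ENNReal.ofReal (Real.exp (q s y)) ^ b ∂μ := by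
          refine lintegral_mono fun s => ?_
          rw [ENNReal.ofReal_rpow_of_pos (Real.exp_pos _), ENNReal.ofReal_rpow_of_pos (Real.exp_pos _),
            ← ENNReal.ofReal_mul (by positivity), ← Real.exp_mul, ← Real.exp_mul, ← Real.exp_add]
          refine ENNReal.ofReal_le_ofReal (Real.exp_le_exp.2 ?_)
          have := (hq s).2 (mem_univ x) (mem_univ y) ha hb hab
          simp only [smul_eq_mul] at this
          linarith
      _ ≤ _ := by
          refine ENNReal.lintegral_mul_norm_pow_le ?_ ?_ ha hb hab
          · exact ((hm x).exp.ennreal_ofReal).aemeasurable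
          · exact ((hm y).exp.ennreal_ofReal).aemeasurable
  have hne : I x ^ a * I y ^ b ≠ ∞ :=
    ENNReal.mul_ne_top (ENNReal.rpow_ne_top_of_nonneg ha (htop x))
      (ENNReal.rpow_ne_top_of_nonneg hb (htop y))
  have hr := ENNReal.toReal_mono hne hold
  rw [ENNReal.toReal_mul, ← ENNReal.toReal_rpow, ← ENNReal.toReal_rpow] at hr
  have := Real.log_le_log (hpos _) hr
  rw [Real.log_mul (Real.rpow_pos_of_pos (hpos x) _).ne' (Real.rpow_pos_of_pos (hpos y) _).ne',
    Real.log_rpow (hpos x), Real.log_rpow (hpos y)] at this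
  simpa using this

lemma lintegral_pi_fin_succ {n : ℕ} (μ : Fin (n + 1) → Measure ℝ)
    [∀ i, IsProbabilityMeasure (μ i)] {u : (Fin (n + 1) → ℝ) → ℝ≥0∞} (hu : Measurable u) :
    ∫⁻ x, u x ∂Measure.pi μ
      = ∫⁻ y, ∫⁻ s, u (Fin.cons s y) ∂μ 0 ∂Measure.pi fun i => μ i.succ := by
  have h := (measurePreserving_piFinSuccAbove μ 0).symm
  rw [← h.lintegral_comp hu, lintegral_prod_symm]
  · simp only [MeasurableEquiv.piFinSuccAbove_symm_apply, Fin.insertNthEquiv, Equiv.coe_fn_mk,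
      Fin.insertNth_zero', Fin.succAbove_zero]
  · exact (hu.comp (MeasurableEquiv.measurable _)).aemeasurable

/-- Maurey's convex property (τ) for product measures on the cube `[0, R]ⁿ`. -/
theorem lintegral_pi_mul_lintegral_exp_neg_le_one_of_convexOn {R : ℝ} (hR : 0 < R) {n : ℕ}
    (μ : Fin n → Measure ℝ) [∀ i, IsProbabilityMeasure (μ i)]
    (hμ : ∀ i, ∀ᵐ x ∂μ i, x ∈ Icc 0 R) {f : (Fin n → ℝ) → ℝ} (hf : ConvexOn ℝ univ f)
    {u : (Fin n → ℝ) → ℝ≥0∞} (hum : Measurable u)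
    (hu : ∀ x y : Fin n → ℝ, (∀ i, x i ∈ Icc 0 R) → (∀ i, y i ∈ Icc 0 R) →
      u x ≤ ENNReal.ofReal (Real.exp (f y + (∑ i, (x i - y i) ^ 2) / (4 * R ^ 2)))) :
    (∫⁻ x, u x ∂Measure.pi μ) * ∫⁻ x, ENNReal.ofReal (Real.exp (-f x)) ∂Measure.pi μ ≤ 1 := by
  induction n with
  | zero =>
    rw [lintegral_unique, lintegral_unique]
    simp only [measure_univ, mul_one]
    refine (mul_le_mul_left (hu _ default (fun i => i.elim0) (fun i => i.elim0)) _).trans ?_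
    rw [← ENNReal.ofReal_mul (Real.exp_pos _).le, ← Real.exp_add,
      Subsingleton.elim (default : Fin 0 → ℝ) 0]
    simp
    exact (congrArg f (Subsingleton.elim _ _)).le
  | succ n ih =>
    have hlin : ∀ (p q : ℝ × (Fin n → ℝ)) (a b : ℝ),
        (Fin.cons (a * p.1 + b * q.1) (a • p.2 + b • q.2) : Fin (n + 1) → ℝ)
          = a • Fin.cons p.1 p.2 + b • Fin.cons q.1 q.2 := by
      intro p q a b
      ext i
      refine Fin.cases ?_ (fun j => ?_) i <;> simp
    have hfc : Continuous f := hf.continuous_of_univ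
    let G : ℝ × (Fin n → ℝ) → ℝ → ℝ := fun p s =>
      f (Fin.cons s p.2) + (p.1 - s) ^ 2 / (4 * R ^ 2)
    have hGconv : ConvexOn ℝ univ fun p : (ℝ × (Fin n → ℝ)) × ℝ => G p.1 p.2 := by
      refine ⟨convex_univ, fun p _ q _ a b ha hb hab => ?_⟩
      have h1 := hf.2 (mem_univ (Fin.cons p.2 p.1.2)) (mem_univ (Fin.cons q.2 q.1.2)) ha hb hab
      rw [← hlin (p.2, p.1.2) (q.2, q.1.2) a b] at h1
      have h2 := (even_two.convexOn_pow (𝕜 := ℝ)).2 (mem_univ (p.1.1 - p.2))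
        (mem_univ (q.1.1 - q.2)) ha hb hab
      simp only [smul_eq_mul] at h1 h2
      have h3 := div_le_div_of_nonneg_right h2 (show 0 ≤ 4 * R ^ 2 by positivity)
      simp only [G, Prod.fst_add, Prod.snd_add, Prod.smul_fst, Prod.smul_snd, smul_eq_mul]
      rw [show a * p.1.1 + b * q.1.1 - (a * p.2 + b * q.2)
        = a * (p.1.1 - p.2) + b * (q.1.1 - q.2) by ring]
      calc _ ≤ _ := add_le_add h1 h3
        _ = _ := by ring
    have hGc : ∀ p, Continuous (G p) := fun p =>
      (hfc.comp (by fun_prop)).add (by fun_prop)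
    have hex : ∀ p, ∃ m, IsLeast (G p '' Icc 0 R) m := fun p =>
      (isCompact_Icc.image (hGc p)).exists_isLeast ((nonempty_Icc.2 hR.le).image _)
    choose q hq using hex
    have hqconv : ConvexOn ℝ univ q := convexOn_univ_of_isLeast (convex_Icc 0 R) hGconv hq
    have hqc : Continuous q := hqconv.continuous_of_univ
    have hqy : ∀ y, Continuous fun s => q (s, y) := fun y => hqc.comp (by fun_prop)
    -- Tensorisation: `q` is the inf-convolution in the first coordinate alone. The induction
    -- hypothesis is applied to `g = log I`, convex by Hölder, and the one-dimensional case on each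
    -- fibre bounds `∫ exp(-f)` by `exp(-g)`.
    set I : (Fin n → ℝ) → ℝ≥0∞ := fun y => ∫⁻ s, ENNReal.ofReal (Real.exp (q (s, y))) ∂μ 0 with hI
    have hI0 : ∀ y, I y ≠ 0 := by
      intro y hy
      rw [hI, lintegral_eq_zero_iff (by have := hqy y; fun_prop)] at hy
      obtain ⟨s, hs⟩ := hy.exists
      simp only [Pi.zero_apply, ENNReal.ofReal_eq_zero] at hs
      exact absurd (Real.exp_pos _) (not_lt.2 hs)
    have hItop : ∀ y, I y ≠ ∞ := by
      intro y
      obtain ⟨C, hC⟩ := isCompact_Icc.bddAbove_image (K := Icc 0 R)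
        (f := fun s => Real.exp (q (s, y))) (by have := hqy y; fun_prop)
      have : I y ≤ ∫⁻ _, ENNReal.ofReal C ∂μ 0 := by
        refine lintegral_mono_ae ?_
        filter_upwards [hμ 0] with s hs
        exact ENNReal.ofReal_le_ofReal (hC ⟨s, hs, rfl⟩)
      refine (this.trans_lt ?_).ne
      simp
    let g : (Fin n → ℝ) → ℝ := fun y => Real.log (I y).toReal
    have hg : ConvexOn ℝ univ g := by
      refine convexOn_log_lintegral_exp (q := fun s y => q (s, y)) (fun s => ?_)
        (fun y => (hqy y).measurable) hI0 hItop
      refine ⟨convex_univ, fun x _ y _ a b ha hb hab => ?_⟩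
      have := hqconv.2 (mem_univ (s, x)) (mem_univ (s, y)) ha hb hab
      simpa [← add_mul, hab] using this
    have hgI : ∀ y, ENNReal.ofReal (Real.exp (g y)) = I y := fun y => by
      rw [Real.exp_log (ENNReal.toReal_pos (hI0 y) (hItop y)), ENNReal.ofReal_toReal (hItop y)]
    have hcons : Measurable fun p : (Fin n → ℝ) × ℝ => (Fin.cons p.2 p.1 : Fin (n + 1) → ℝ) := by
      have : Continuous fun p : (Fin n → ℝ) × ℝ => (Fin.cons p.2 p.1 : Fin (n + 1) → ℝ) := by
        fun_prop
      exact this.measurable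
    have key := ih (fun i => μ i.succ) (fun i => hμ i.succ) hg
      (u := fun y => ∫⁻ s, u (Fin.cons s y) ∂μ 0)
      (hum.comp hcons).lintegral_prod_right' (by
        intro x y hx hy
        rw [Real.exp_add, ENNReal.ofReal_mul (Real.exp_pos _).le, hgI,
          ← lintegral_mul_const _ (by have := hqy y; fun_prop)]
        refine lintegral_mono_ae ?_
        filter_upwards [hμ 0] with s hs
        obtain ⟨t, ht, hts⟩ := (hq (s, y)).1
        refine (hu (Fin.cons s x) (Fin.cons t y) (Fin.cases hs hx) (Fin.cases ht hy)).trans ?_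
        rw [← ENNReal.ofReal_mul (Real.exp_pos _).le, ← Real.exp_add, ← hts]
        refine ENNReal.ofReal_le_ofReal (Real.exp_le_exp.2 (le_of_eq ?_))
        simp only [G, Fin.sum_univ_succ, Fin.cons_zero, Fin.cons_succ]
        ring)
    have hone : ∀ y, I y * ∫⁻ s, ENNReal.ofReal (Real.exp (-f (Fin.cons s y))) ∂μ 0 ≤ 1 := by
      intro y
      refine lintegral_mul_lintegral_exp_neg_le_one_of_convexOn hR (hμ 0)
        (f := fun s => f (Fin.cons s y)) ?_ ?_
      · refine ⟨convex_univ, fun s _ t _ a b ha hb hab => ?_⟩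
        have := hf.2 (mem_univ (Fin.cons s y)) (mem_univ (Fin.cons t y)) ha hb hab
        rw [← hlin (s, y) (t, y) a b, ← add_smul, hab, one_smul] at this
        simpa using this
      · intro s hs t ht
        exact ENNReal.ofReal_le_ofReal (Real.exp_le_exp.2 ((hq (s, y)).2 ⟨t, ht, rfl⟩))
    rw [lintegral_pi_fin_succ μ hum, lintegral_pi_fin_succ μ (by fun_prop)]
    refine (mul_le_mul_right (lintegral_mono fun y => ?_) _).trans key
    rw [Real.exp_neg, ENNReal.ofReal_inv_of_pos (Real.exp_pos _), hgI]
    exact ENNReal.le_inv_iff_mul_le.2 (by rw [mul_comm]; exact hone y)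

end BandCirculant

/-! ### Energy of band circulants: convexity and Lipschitz bound -/

namespace BandCirculant

open Set Matrix

lemma energy_eq_sum_sqrt_of_charpoly {n : ℕ} {A : Matrix (Fin n) (Fin n) ℝ} {d : Fin n → ℝ}
    (h : (Aᴴ * A).charpoly = ∏ r, (Polynomial.X - Polynomial.C (d r))) :
    energy A = ∑ r, √(d r) := by
  have h2 := (isHermitian_conjTranspose_mul_self A).roots_charpoly_eq_eigenvalues
  rw [h, Polynomial.roots_prod _ _ (Finset.prod_ne_zero_iff.2 fun i _ =>
    Polynomial.X_sub_C_ne_zero _)] at h2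
  have h3 := congrArg (fun m => (m.map Real.sqrt).sum) h2
  simp only [Polynomial.roots_X_sub_C, Multiset.bind_singleton, Multiset.map_map] at h3
  exact h3.symm

/-- Cauchy–Schwarz on the singular values, whose squares sum to `tr A*A`. -/
lemma energy_sq_le {n : ℕ} (A : Matrix (Fin n) (Fin n) ℝ) :
    energy A ^ 2 ≤ n * ∑ j, ∑ i, A i j ^ 2 := by
  have hH := isHermitian_conjTranspose_mul_self A
  have htr : ∑ r, hH.eigenvalues r = ∑ j, ∑ i, A i j ^ 2 := by
    have := hH.trace_eq_sum_eigenvalues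
    simp only [RCLike.ofReal_real_eq_id, id] at this
    rw [← this]
    simp [Matrix.trace, Matrix.mul_apply, sq]
  have h := sq_sum_le_card_mul_sum_sq (s := Finset.univ) (f := fun r => √(hH.eigenvalues r))
  rw [Finset.sum_congr rfl fun r _ =>
    Real.sq_sqrt ((posSemidef_conjTranspose_mul_self A).eigenvalues_nonneg r)] at h
  rw [Finset.card_univ, Fintype.card_fin, htr] at h
  exact h

/-- The `r`-th Fourier coefficient of a real tuple of length `n`. -/
noncomputable def fourierCoeff {n : ℕ} (a : Fin n → ℝ) (r : Fin n) : ℂ :=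
  ∑ k : Fin n, a k * (Complex.exp (2 * Real.pi * Complex.I / n) ^ (r : ℕ)) ^ (k : ℕ)

/-- The energy of a circulant matrix is the sum of the moduli of the Fourier coefficients. -/
theorem energy_circ {n : ℕ} (a : Fin n → ℝ) :
    energy (circ a) = ∑ r, ‖fourierCoeff a r‖ := by
  rcases Nat.eq_zero_or_pos n with rfl | hn
  · simp [energy]
  have : NeZero n := ⟨hn.ne'⟩
  set ζ : ℂ := Complex.exp (2 * Real.pi * Complex.I / n) with hζ
  have hprim : IsPrimitiveRoot ζ n := Complex.isPrimitiveRoot_exp n hn.ne'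
  set v : Fin n → ℂ := fun r => ζ ^ (r : ℕ) with hv
  have hvn : ∀ r, v r ^ n = 1 := fun r => by
    rw [hv, ← pow_mul, mul_comm, pow_mul, hprim.pow_eq_one, one_pow]
  have hvadd : ∀ r (i j : Fin n), v r ^ ((i + j : Fin n) : ℕ) = v r ^ (i : ℕ) * v r ^ (j : ℕ) := by
    intro r i j
    rw [Fin.val_add, ← pow_add]
    conv_rhs => rw [← Nat.mod_add_div (i + j : ℕ) n, pow_add, pow_mul, hvn, one_pow, mul_one]
  have hvconj : ∀ r (k : Fin n), starRingEnd ℂ (v r ^ (k : ℕ)) * v r ^ (k : ℕ) = 1 := by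
    intro r k
    rw [mul_comm, Complex.mul_conj, Complex.normSq_eq_norm_sq]
    have : ‖v r‖ = 1 := Complex.norm_eq_one_of_pow_eq_one (hvn r) hn.ne'
    simp [this]
  set A : Matrix (Fin n) (Fin n) ℂ := (circ a).map Complex.ofReal with hA
  set V := vandermonde v with hV
  have hinj : Function.Injective v := fun r s h =>
    Fin.ext (hprim.pow_inj r.2 s.2 h)
  have hdet : IsUnit V.det := (det_vandermonde_ne_zero_iff.2 hinj).isUnit
  -- The rows of `V` are the characters of `ℤ/n`: common left eigenvectors of `Aᵀ` and `A`, with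
  -- conjugate eigenvalues since `a` is real.
  have h1 : V * Aᵀ = diagonal (fourierCoeff a) * V := by
    ext r j
    rw [mul_apply, diagonal_mul, fourierCoeff, Finset.sum_mul,
      ← Equiv.sum_comp (Equiv.addRight j)]
    refine Finset.sum_congr rfl fun k _ => ?_
    simp only [Equiv.coe_addRight, hV, vandermonde_apply, hvadd, transpose_apply, hA, map_apply,
      circ_apply, add_sub_cancel_right]
    ring
  have h2 : V * A = diagonal (fun r => starRingEnd ℂ (fourierCoeff a r)) * V := by
    ext r j
    rw [mul_apply, diagonal_mul, fourierCoeff, map_sum, Finset.sum_mul,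
      ← Equiv.sum_comp (Equiv.subLeft j)]
    refine Finset.sum_congr rfl fun k _ => ?_
    have e : v r ^ (j : ℕ) = v r ^ ((j - k : Fin n) : ℕ) * v r ^ (k : ℕ) := by
      rw [← hvadd, sub_add_cancel]
    simp only [Equiv.subLeft_apply, hV, vandermonde_apply, hA, map_apply, circ_apply,
      sub_sub_cancel, map_mul, Complex.conj_ofReal]
    rw [e]
    have := hvconj r k
    linear_combination (-(a k : ℂ) * v r ^ ((j - k : Fin n) : ℕ)) * this
  have h3 : V * (Aᵀ * A) = diagonal (fun r => (((‖fourierCoeff a r‖ ^ 2 : ℝ)) : ℂ)) * V := by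
    rw [← Matrix.mul_assoc, h1, Matrix.mul_assoc, h2, ← Matrix.mul_assoc, diagonal_mul_diagonal]
    congr 2
    ext r
    rw [Complex.mul_conj, Complex.normSq_eq_norm_sq]
  have h4 : (Aᵀ * A).charpoly
      = ∏ r, (Polynomial.X - Polynomial.C (((‖fourierCoeff a r‖ ^ 2 : ℝ)) : ℂ)) := by
    rw [← charpoly_diagonal, ← charpoly_units_conj (V.nonsingInvUnit hdet)]
    congr 1
    rw [Matrix.mul_assoc]
    change V * (Aᵀ * A * V⁻¹) = _
    rw [← Matrix.mul_assoc, h3, Matrix.mul_assoc, Matrix.mul_nonsing_inv _ hdet, Matrix.mul_one]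
  have h5 : ((circ a)ᴴ * circ a).charpoly
      = ∏ r, (Polynomial.X - Polynomial.C (‖fourierCoeff a r‖ ^ 2)) := by
    apply Polynomial.map_injective Complex.ofRealHom Complex.ofRealHom.injective
    have e : ((circ a)ᴴ * circ a).map Complex.ofRealHom = Aᵀ * A := by
      rw [Matrix.map_mul]; rfl
    rw [← Matrix.charpoly_map, e, h4, Polynomial.map_prod]
    simp
  rw [energy_eq_sum_sqrt_of_charpoly h5]
  exact Finset.sum_congr rfl fun r _ => Real.sqrt_sq (norm_nonneg _)

lemma fourierCoeff_combo {n : ℕ} (a c : Fin n → ℝ) (s t : ℝ) (r : Fin n) :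
    fourierCoeff (s • a + t • c) r = s * fourierCoeff a r + t * fourierCoeff c r := by
  simp only [fourierCoeff, Finset.mul_sum, ← Finset.sum_add_distrib]
  refine Finset.sum_congr rfl fun k _ => ?_
  simp only [Pi.add_apply, Pi.smul_apply, smul_eq_mul]
  push_cast
  ring

lemma bandTuple_combo (n b : ℕ) (x y : Fin b → ℝ) (s t : ℝ) :
    bandTuple n b (s • x + t • y) = s • bandTuple n b x + t • bandTuple n b y := by
  ext k
  simp only [bandTuple, Pi.add_apply, Pi.smul_apply, smul_eq_mul]
  split_ifs <;> simp

/-- The triangle inequality on each Fourier coefficient. Arbitrary `s`, `t` serve both convexity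
and, with `s = t = 1`, the Lipschitz bound. -/
lemma energy_bandCirc_combo_le (n b : ℕ) (x y : Fin b → ℝ) (s t : ℝ) :
    energy (bandCirc n b (s • x + t • y))
      ≤ |s| * energy (bandCirc n b x) + |t| * energy (bandCirc n b y) := by
  simp only [bandCirc, energy_circ, bandTuple_combo, fourierCoeff_combo, Finset.mul_sum,
    ← Finset.sum_add_distrib]
  refine Finset.sum_le_sum fun r _ => (norm_add_le _ _).trans_eq ?_
  simp

lemma convexOn_energy_bandCirc (n b : ℕ) :
    ConvexOn ℝ univ fun x : Fin b → ℝ => energy (bandCirc n b x) := by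
  refine ⟨convex_univ, fun x _ y _ s t hs ht _ => ?_⟩
  simpa [abs_of_nonneg hs, abs_of_nonneg ht] using energy_bandCirc_combo_le n b x y s t

lemma sum_bandTuple_sq {n b : ℕ} (hbn : 2 * b < n) (x : Fin b → ℝ) :
    ∑ k, bandTuple n b x k ^ 2 = 2 * ∑ j, x j ^ 2 := by
  -- Each `x j` sits at positions `j + 1` and `n - (j + 1)`; `2 * b < n` keeps the two blocks
  -- disjoint.
  have h : ∀ k : Fin n, bandTuple n b x k ^ 2
      = ∑ j : Fin b, ((if k = ⟨j + 1, by omega⟩ then x j ^ 2 else 0)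
        + if k = ⟨n - (j + 1), by omega⟩ then x j ^ 2 else 0) := by
    intro k
    unfold bandTuple
    rw [Finset.sum_add_distrib]
    split_ifs with h1 h2
    · rw [Finset.sum_eq_single ⟨(k : ℕ) - 1, by omega⟩, Finset.sum_eq_zero, if_pos, add_zero]
      · ext; simp; omega
      · intro j _; rw [if_neg]; simp [Fin.ext_iff]; omega
      · intro j _ hj; rw [if_neg]; simp [Fin.ext_iff] at hj ⊢; omega
      · simp
    · rw [Finset.sum_eq_zero, Finset.sum_eq_single ⟨n - (k : ℕ) - 1, by omega⟩, if_pos, zero_add]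
      · ext; simp; omega
      · intro j _ hj; rw [if_neg]; simp [Fin.ext_iff] at hj ⊢; omega
      · simp
      · intro j _; rw [if_neg]; simp [Fin.ext_iff]; omega
    · rw [Finset.sum_eq_zero, Finset.sum_eq_zero]
      · simp
      · intro j _; rw [if_neg]; simp [Fin.ext_iff]; omega
      · intro j _; rw [if_neg]; simp [Fin.ext_iff]; omega
  simp only [h]
  rw [Finset.sum_comm, Finset.mul_sum]
  refine Finset.sum_congr rfl fun j _ => ?_
  rw [Finset.sum_add_distrib]
  simp [two_mul]

/-- `energy ∘ bandCirc` is `n √2`-Lipschitz for the Euclidean norm. -/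
lemma energy_bandCirc_le_add {n b : ℕ} (hbn : 2 * b < n) (x y : Fin b → ℝ) :
    energy (bandCirc n b x)
      ≤ energy (bandCirc n b y) + n * √2 * √(∑ j, (x j - y j) ^ 2) := by
  have : NeZero n := ⟨by omega⟩
  have h1 := energy_bandCirc_combo_le n b (x - y) y 1 1
  simp only [one_smul, sub_add_cancel, abs_one, one_mul] at h1
  have h2 : energy (bandCirc n b (x - y)) ^ 2 ≤ (n * √2 * √(∑ j, (x j - y j) ^ 2)) ^ 2 := by
    refine (energy_sq_le _).trans_eq ?_
    have : ∀ j : Fin n, ∑ i, bandCirc n b (x - y) i j ^ 2 = 2 * ∑ j, (x j - y j) ^ 2 := by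
      intro j
      rw [← Finset.sum_congr rfl fun k _ => congrArg (· ^ 2) (Pi.sub_apply x y k),
        ← sum_bandTuple_sq hbn (x - y)]
      exact Equiv.sum_comp (Equiv.subLeft j) fun k => bandTuple n b (x - y) k ^ 2
    simp only [this, Finset.sum_const, Finset.card_univ, Fintype.card_fin, nsmul_eq_mul]
    rw [mul_pow, mul_pow, Real.sq_sqrt (by norm_num),
      Real.sq_sqrt (Finset.sum_nonneg fun _ _ => sq_nonneg _)]
    ring
  have h3 := le_of_sq_le_sq h2 (by positivity)
  linarith

end BandCirculant

/-! ### Sub-Gaussian concentration -/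

namespace BandCirculant

open Set ENNReal

variable {Ω : Type*} [MeasurableSpace Ω] {P : Measure Ω}

lemma exists_ae_norm_le_of_continuous {b : ℕ} {R : ℝ} {ξ : Fin b → Ω → ℝ}
    (hrange : ∀ k, ∀ᵐ ω ∂P, ξ k ω ∈ Icc 0 R) {F : (Fin b → ℝ) → ℝ} (hF : Continuous F) :
    ∃ C, ∀ᵐ ω ∂P, ‖F fun k => ξ k ω‖ ≤ C := by
  obtain ⟨C, hC⟩ := (isCompact_univ_pi fun _ : Fin b =>
    isCompact_Icc (a := 0) (b := R)).exists_bound_of_continuousOn hF.continuousOn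
  refine ⟨C, ?_⟩
  filter_upwards [ae_all_iff.2 hrange] with ω hω
  exact hC _ fun k _ => hω k

lemma measureReal_le_abs_le {X : Ω → ℝ} {c : NNReal} (hX : HasSubgaussianMGF X c P) {ε : ℝ}
    (hε : 0 ≤ ε) : P.real {ω | ε ≤ |X ω|} ≤ 2 * Real.exp (-ε ^ 2 / (2 * c)) := by
  have : {ω | ε ≤ |X ω|} = {ω | ε ≤ X ω} ∪ {ω | ε ≤ (-X) ω} := by
    ext ω; simp [le_abs]
  rw [this, two_mul]
  exact (measureReal_union_le _ _).trans
    (add_le_add (hX.measure_ge_le hε) (hX.neg.measure_ge_le hε))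

variable [IsProbabilityMeasure P]

lemma integrable_of_continuous {b : ℕ} {R : ℝ} {ξ : Fin b → Ω → ℝ}
    (hmeas : ∀ k, Measurable (ξ k)) (hrange : ∀ k, ∀ᵐ ω ∂P, ξ k ω ∈ Icc 0 R)
    {F : (Fin b → ℝ) → ℝ} (hF : Continuous F) : Integrable (fun ω => F fun k => ξ k ω) P := by
  obtain ⟨C, hC⟩ := exists_ae_norm_le_of_continuous hrange hF
  exact Integrable.of_bound (hF.measurable.comp (measurable_pi_lambda _ hmeas)).aestronglyMeasurable
    C hC

/-- For a convex function that is `L`-Lipschitz in the Euclidean norm, of independent variables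
in `[0, R]`. -/
lemma mgf_mul_mgf_neg_le {b : ℕ} {R L : ℝ} (hR : 0 < R) {ξ : Fin b → Ω → ℝ}
    (hmeas : ∀ k, Measurable (ξ k)) (hindep : iIndepFun ξ P)
    (hrange : ∀ k, ∀ᵐ ω ∂P, ξ k ω ∈ Icc 0 R) {F : (Fin b → ℝ) → ℝ} (hF : ConvexOn ℝ univ F)
    (hL : ∀ x y, F x ≤ F y + L * √(∑ k, (x k - y k) ^ 2)) {t : ℝ} (ht : 0 ≤ t) :
    mgf (fun ω => F fun k => ξ k ω) P t * mgf (fun ω => F fun k => ξ k ω) P (-t)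
      ≤ Real.exp (t ^ 2 * L ^ 2 * R ^ 2) := by
  have hFc : Continuous F := hF.continuous_of_univ
  have hξ : Measurable fun ω k => ξ k ω := measurable_pi_lambda _ hmeas
  have (k : Fin b) : IsProbabilityMeasure (P.map (ξ k)) :=
    Measure.isProbabilityMeasure_map (hmeas k).aemeasurable
  have hmap := (iIndepFun_iff_map_fun_eq_pi_map fun k => (hmeas k).aemeasurable).1 hindep
  have hF' : ConvexOn ℝ univ fun x => t * F x := hF.smul ht
  have key := lintegral_pi_mul_lintegral_exp_neg_le_one_of_convexOn hR (fun k => P.map (ξ k))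
    (fun k => (ae_map_iff (hmeas k).aemeasurable measurableSet_Icc).2 (hrange k)) hF'
    (u := fun x => ENNReal.ofReal (Real.exp (t * F x - t ^ 2 * L ^ 2 * R ^ 2))) (by fun_prop) (by
      intro x y _ _
      refine ENNReal.ofReal_le_ofReal (Real.exp_le_exp.2 ?_)
      have h1 := mul_le_mul_of_nonneg_left (hL x y) ht
      have h2 : 0 ≤ ∑ k, (x k - y k) ^ 2 := Finset.sum_nonneg fun _ _ => sq_nonneg _
      -- Completing the square: `tL√S - S/(4R²) ≤ t²L²R²`.
      set S := ∑ k, (x k - y k) ^ 2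
      have h3 : S / (4 * R ^ 2) = (√S / (2 * R)) ^ 2 := by
        rw [div_pow, Real.sq_sqrt h2]; ring
      have h4 : t * (L * √S) = 2 * (√S / (2 * R)) * (t * L * R) := by field_simp
      rw [h3]
      nlinarith [sq_nonneg (√S / (2 * R) - t * L * R)])
  rw [← hmap, lintegral_map (by fun_prop) hξ, lintegral_map (by fun_prop) hξ,
    ← ofReal_integral_eq_lintegral_ofReal, ← ofReal_integral_eq_lintegral_ofReal,
    ← ENNReal.ofReal_mul (integral_nonneg fun _ => (Real.exp_pos _).le),
    ENNReal.ofReal_le_one] at key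
  · simp only [sub_eq_add_neg, Real.exp_add] at key
    rw [integral_mul_const, Real.exp_neg] at key
    simp only [mgf, neg_mul]
    have := Real.exp_pos (t ^ 2 * L ^ 2 * R ^ 2)
    rwa [mul_right_comm, ← div_eq_mul_inv, div_le_one this] at key
  · exact integrable_of_continuous (F := fun x => Real.exp (-(t * F x))) hmeas hrange (by fun_prop)
  · exact .of_forall fun _ => (Real.exp_pos _).le
  · exact integrable_of_continuous
      (F := fun x => Real.exp (t * F x - t ^ 2 * L ^ 2 * R ^ 2)) hmeas hrange (by fun_prop)
  · exact .of_forall fun _ => (Real.exp_pos _).le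

/-- Jensen's inequality, through `1 + s ≤ exp s`. -/
lemma one_le_mgf_sub_integral {X : Ω → ℝ} (hX : Integrable X P) {t : ℝ}
    (ht : Integrable (fun ω => Real.exp (t * (X ω - ∫ ω', X ω' ∂P))) P) :
    1 ≤ mgf (fun ω => X ω - ∫ ω', X ω' ∂P) P t := by
  have h0 : Integrable (fun ω => t * (X ω - ∫ ω', X ω' ∂P)) P :=
    (hX.sub (integrable_const _)).const_mul t
  have h1 : ∫ ω, (t * (X ω - ∫ ω', X ω' ∂P) + 1) ∂P = 1 := by
    rw [integral_add h0 (integrable_const _), integral_const_mul,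
      integral_sub hX (integrable_const _)]
    simp
  rw [← h1]
  exact integral_mono (h0.add (integrable_const _)) ht fun ω => Real.add_one_le_exp _

/-- Convex functions that are Lipschitz in the Euclidean norm concentrate on product spaces. -/
theorem hasSubgaussianMGF_of_convexOn {b : ℕ} {R L : ℝ} (hR : 0 < R) {ξ : Fin b → Ω → ℝ}
    (hmeas : ∀ k, Measurable (ξ k)) (hindep : iIndepFun ξ P)
    (hrange : ∀ k, ∀ᵐ ω ∂P, ξ k ω ∈ Icc 0 R) {F : (Fin b → ℝ) → ℝ} (hF : ConvexOn ℝ univ F)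
    (hL : ∀ x y, F x ≤ F y + L * √(∑ k, (x k - y k) ^ 2)) :
    HasSubgaussianMGF (fun ω => (F fun k => ξ k ω) - ∫ ω', F (fun k => ξ k ω') ∂P)
      (2 * L ^ 2 * R ^ 2).toNNReal P := by
  have hFc : Continuous F := hF.continuous_of_univ
  set m := ∫ ω', F (fun k => ξ k ω') ∂P with hm
  have hint : ∀ t : ℝ, Integrable (fun ω => Real.exp (t * ((F fun k => ξ k ω) - m))) P := fun t =>
    integrable_of_continuous (F := fun x => Real.exp (t * (F x - m))) hmeas hrange (by fun_prop)
  have hFi := integrable_of_continuous hmeas hrange hFc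
  have hone : ∀ t, 1 ≤ mgf (fun ω => (F fun k => ξ k ω) - m) P t := fun t =>
    one_le_mgf_sub_integral hFi (hint t)
  have hprod : ∀ t, 0 ≤ t → mgf (fun ω => (F fun k => ξ k ω) - m) P t
      * mgf (fun ω => (F fun k => ξ k ω) - m) P (-t) ≤ Real.exp (t ^ 2 * L ^ 2 * R ^ 2) := by
    intro t ht
    refine mgf_mul_mgf_neg_le hR hmeas hindep hrange (F := fun x => F x - m) ?_ ?_ ht
    · exact hF.add_const (-m)
    · intro x y
      linarith [hL x y]
  refine ⟨hint, fun t => ?_⟩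
  rw [Real.coe_toNNReal _ (by positivity),
    show 2 * L ^ 2 * R ^ 2 * t ^ 2 / 2 = t ^ 2 * L ^ 2 * R ^ 2 by ring]
  rcases le_total 0 t with ht | ht
  · exact (le_mul_of_one_le_right mgf_nonneg (hone (-t))).trans (hprod t ht)
  · have := hprod (-t) (by linarith)
    rw [neg_neg, neg_sq] at this
    exact (le_mul_of_one_le_left mgf_nonneg (hone (-t))).trans this

end BandCirculant

theorem theorem2 {Ω : Type*} [MeasurableSpace Ω] (P : Measure Ω) [IsProbabilityMeasure P]
    (n b : ℕ) (hb : 1 ≤ b) (hbn : 2 * b < n)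
    (R : ℝ) (hR : 0 < R)
    (ξ : Fin b → Ω → ℝ)
    (hmeas : ∀ k, Measurable (ξ k))
    (hindep : iIndepFun ξ P)
    (hident : ∀ k l, IdentDistrib (ξ k) (ξ l) P P)
    (hrange : ∀ k, ∀ᵐ ω ∂P, ξ k ω ∈ Set.Icc 0 R) :
    Integrable (fun ω => BandCirculant.energy (BandCirculant.bandCirc n b fun k => ξ k ω)) P ∧
    ∀ δ : ℝ, BandCirculant.delta0 R b ≤ δ →
      P.real {ω | δ ≤
          |1 / ((n : ℝ) * √(b : ℝ)) *
              BandCirculant.energy (BandCirculant.bandCirc n b fun k => ξ k ω)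
            - 1 / ((n : ℝ) * √(b : ℝ)) *
              ∫ ω', BandCirculant.energy (BandCirculant.bandCirc n b fun k => ξ k ω') ∂P|}
        ≤ 4 * Real.exp (-((b : ℝ) / (8 * R ^ 2)) * (δ - BandCirculant.delta0 R b) ^ 2) := by
  have hconv := BandCirculant.convexOn_energy_bandCirc n b
  refine ⟨BandCirculant.integrable_of_continuous hmeas hrange hconv.continuous_of_univ,
    fun δ hδ => ?_⟩
  have hb0 : (0 : ℝ) < b := by exact_mod_cast hb
  have hn0 : (0 : ℝ) < n := by exact_mod_cast (by omega : 0 < n)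
  have hδ0 : 0 ≤ BandCirculant.delta0 R b := by unfold BandCirculant.delta0; positivity
  have hc : 0 ≤ 1 / ((n : ℝ) * √(b : ℝ)) := by positivity
  -- Here `L` is the Lipschitz constant `n√2` divided by `n√b`, so the variance proxy is `4R²/b`.
  have hsub := BandCirculant.hasSubgaussianMGF_of_convexOn (L := √2 / √b) hR hmeas hindep hrange
    (F := fun x => 1 / ((n : ℝ) * √(b : ℝ)) * BandCirculant.energy (BandCirculant.bandCirc n b x))
    (hconv.smul hc) (fun x y => by
      refine (mul_le_mul_of_nonneg_left (BandCirculant.energy_bandCirc_le_add hbn x y)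
        hc).trans_eq ?_
      field_simp)
  simp only [integral_const_mul] at hsub
  refine (BandCirculant.measureReal_le_abs_le hsub (hδ0.trans hδ)).trans ?_
  rw [Real.coe_toNNReal _ (by positivity), div_pow, Real.sq_sqrt (by norm_num),
    Real.sq_sqrt hb0.le]
  -- The bound in hand is `2 exp(-bδ²/(8R²))`; it is weakened by `2 ≤ 4` and `0 ≤ δ - delta0 ≤ δ`.
  refine mul_le_mul (by norm_num) (Real.exp_le_exp.2 ?_) (Real.exp_pos _).le (by norm_num)
  have h1 : (δ - BandCirculant.delta0 R b) ^ 2 ≤ δ ^ 2 :=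
    pow_le_pow_left₀ (by linarith) (by linarith) 2
  have h2 := mul_le_mul_of_nonneg_left h1 (show 0 ≤ (b : ℝ) / (8 * R ^ 2) by positivity)
  rw [show -δ ^ 2 / (2 * (2 * (2 / (b : ℝ)) * R ^ 2)) = -((b : ℝ) / (8 * R ^ 2) * δ ^ 2) by
    field_simp; ring]
  linarith
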